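/- Conventions. A Hilbert couple is a pair $\overline{\mathcal H}=(\mathcal H_0,\mathcal H_1)$ of complex Hilbert spaces, both continuously embedded in a common Hausdorff topological vector space. It is regular if $\Delta=\mathcal H_0\cap\mathcal H_1$ is dense in $\mathcal H_0$ and in $\mathcal H_1$. For $x\in\Sigma=\mathcal H_0+\mathcal H_1$ and $t>0$ put $$K(t,x)=K(t,x;\overline{\mathcal H})=\inf_{x=x_0+x_1}\left\{\|x_0\|_0^2+t\|x_1\|_1^2\right\}.$$ For a regular couple, $A$ denotes the positive injective operator in $\mathcal H_0$ that represents the quadratic form $\|\cdot\|_1^2$ on $\Delta$, i.e. $\|x\|_1^2=\langle Ax,x\rangle_0$. The couple has the $K$-property if, whenever $x^0,y^0\in\Sigma$ satisfy $K(t,y^0)\le K(t,x^0)$ for all $t>0$, there is a linear map $T:\Sigma\to\Sigma$ whose restrictions to $\mathcal H_0$ and $\mathcal H_1$ are bounded operators $\mathcal H_i\to\mathcal H_i$ of norm at most $1$ $(i=0,1)$ and such that $Tx^0=y^0$. **Theorem 2.5.** Suppose that a regular Hilbert couple $\overline{\mathcal H}$ is finite dimensional and that all eigenvalues of the corresponding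 operator $A$ are of unit multiplicity. Then $\overline{\mathcal H}$ has the $K$-property. In coordinates: let $0<\lambda_1<\dots<\lambda_n$, and on $\mathbf C^n$ put $\|x\|_0^2=\sum_{i=1}^n|x_i|^2$ and $\|x\|_1^2=\sum_{i=1}^n\lambda_i|x_i|^2$; let $k_\lambda(t,x)=K(1/t,x)$, where $K$ is the $K$-functional of this couple $(\ell_2^n,\ell_2^n(\lambda))$. If $x^0,y^0\in\mathbf C^n$ satisfy $k_\lambda(t,y^0)\le k_\lambda(t,x^0)$ for all $t>0$, then there is a matrix $T\in M_n(\mathbf C)$ with $Tx^0=y^0$, and $\|Tx\|_0\le\|x\|_0$ and $\|Tx\|_1\le\|x\|_1$ for all $x\in\mathbf C^n$. -/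

import Mathlib

open scoped ENNReal InnerProductSpace Matrix ComplexConjugate

noncomputable section

/-- A compatible couple of complex Hilbert spaces: `H₀` and `H₁` are both continuously and
injectively embedded in a common Hausdorff topological vector space `M`. -/
structure HilbertCouple (M H₀ H₁ : Type*)
    [AddCommGroup M] [Module ℂ M] [TopologicalSpace M] [IsTopologicalAddGroup M]
    [ContinuousSMul ℂ M] [T2Space M]
    [NormedAddCommGroup H₀] [InnerProductSpace ℂ H₀] [CompleteSpace H₀]
    [NormedAddCommGroup H₁] [InnerProductSpace ℂ H₁] [CompleteSpace H₁] where
  emb₀ : H₀ →L[ℂ] M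
  emb₁ : H₁ →L[ℂ] M
  injective_emb₀ : Function.Injective emb₀
  injective_emb₁ : Function.Injective emb₁

namespace HilbertCouple

section Couple

variable {M H₀ H₁ : Type*}
  [AddCommGroup M] [Module ℂ M] [TopologicalSpace M] [IsTopologicalAddGroup M]
  [ContinuousSMul ℂ M] [T2Space M]
  [NormedAddCommGroup H₀] [InnerProductSpace ℂ H₀] [CompleteSpace H₀]
  [NormedAddCommGroup H₁] [InnerProductSpace ℂ H₁] [CompleteSpace H₁]

/-- The couple is regular: `H₀ ∩ H₁` is dense in `H₀` and in `H₁`. -/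
def Regular (C : HilbertCouple M H₀ H₁) : Prop :=
  Dense {u : H₀ | ∃ v : H₁, C.emb₀ u = C.emb₁ v} ∧
    Dense {v : H₁ | ∃ u : H₀, C.emb₀ u = C.emb₁ v}

/-- The sum `Σ = H₀ + H₁`, as a subspace of `M`. -/
def sum (C : HilbertCouple M H₀ H₁) : Submodule ℂ M :=
  LinearMap.range (C.emb₀ : H₀ →ₗ[ℂ] M) ⊔ LinearMap.range (C.emb₁ : H₁ →ₗ[ℂ] M)

theorem emb₀_mem_sum (C : HilbertCouple M H₀ H₁) (u : H₀) : C.emb₀ u ∈ C.sum :=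
  Submodule.mem_sup_left ⟨u, rfl⟩

theorem emb₁_mem_sum (C : HilbertCouple M H₀ H₁) (v : H₁) : C.emb₁ v ∈ C.sum :=
  Submodule.mem_sup_right ⟨v, rfl⟩

/-- The (quadratic) K-functional `K(t, x) = inf {‖x₀‖₀² + t ‖x₁‖₁² : x = x₀ + x₁}`; the value is
`∞` when `x` has no such decomposition, i.e. when `x ∉ Σ`. -/
def K (C : HilbertCouple M H₀ H₁) (t : ℝ) (x : M) : ℝ≥0∞ :=
  ⨅ (u : H₀) (v : H₁) (_ : x = C.emb₀ u + C.emb₁ v),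
    ENNReal.ofReal (‖u‖ ^ 2 + t * ‖v‖ ^ 2)

/-- The graph of the operator in `H₀` that represents the form `‖·‖₁²` with domain `H₀ ∩ H₁`:
the pairs `(x, y)` with `x ∈ H₀ ∩ H₁` and `⟨z, x⟩₁ = ⟨z, y⟩₀` for all `z ∈ H₀ ∩ H₁`. -/
def operatorGraph (C : HilbertCouple M H₀ H₁) : Submodule ℂ (H₀ × H₀) where
  carrier := {p | ∃ v : H₁, C.emb₀ p.1 = C.emb₁ v ∧
    ∀ (z₀ : H₀) (z₁ : H₁), C.emb₀ z₀ = C.emb₁ z₁ → ⟪z₁, v⟫_ℂ = ⟪z₀, p.2⟫_ℂ}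
  zero_mem' := ⟨0, by simp, by simp⟩
  add_mem' := by
    rintro p q ⟨v, hv, h⟩ ⟨v', hv', h'⟩
    refine ⟨v + v', by simp [hv, hv'], fun z₀ z₁ hz => ?_⟩
    rw [inner_add_right, h z₀ z₁ hz, h' z₀ z₁ hz, ← inner_add_right, Prod.snd_add]
  smul_mem' := by
    rintro c p ⟨v, hv, h⟩
    refine ⟨c • v, by simp [hv], fun z₀ z₁ hz => ?_⟩
    rw [inner_smul_right, h z₀ z₁ hz, ← inner_smul_right, Prod.smul_snd]

/-- The positive operator `A` in `H₀` with `‖x‖₁² = ⟨A x, x⟩₀`, as a partially defined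
operator. -/
def operator (C : HilbertCouple M H₀ H₁) : H₀ →ₗ.[ℂ] H₀ :=
  C.operatorGraph.toLinearPMap

/-- For a regular couple the operator is well defined: its graph is `operatorGraph`. -/
theorem Regular.graph_operator {C : HilbertCouple M H₀ H₁} (hC : C.Regular) :
    C.operator.graph = C.operatorGraph := by
  refine Submodule.toLinearPMap_graph_eq _ ?_
  rintro ⟨x, y⟩ ⟨v, hv, h⟩ hx
  simp only at hx hv h ⊢
  subst hx
  have hv0 : v = 0 := by
    apply C.injective_emb₁
    simpa using hv.symm
  subst hv0
  refine hC.1.eq_zero_of_inner_left ℂ ?_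
  rintro z ⟨z₁, hz⟩
  have hzy : ⟪z, y⟫_ℂ = 0 := by rw [← h z z₁ hz, inner_zero_right]
  exact inner_eq_zero_symm.1 hzy

/-- The eigenspace `{x ∈ dom A : A x = μ x}` of the operator `A` of the couple. -/
def operatorEigenspace (C : HilbertCouple M H₀ H₁) (μ : ℂ) : Submodule ℂ H₀ :=
  C.operator.graph.comap (LinearMap.id.prod (μ • LinearMap.id))

/-- All eigenvalues of the operator `A` of the couple are of unit multiplicity. -/
def HasSimpleEigenvalues (C : HilbertCouple M H₀ H₁) : Prop :=
  ∀ μ : ℂ, C.operatorEigenspace μ ≠ ⊥ → Module.finrank ℂ (C.operatorEigenspace μ) = 1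

end Couple

section CoupleMap

variable {M H₀ H₁ N K₀ K₁ : Type*}
  [AddCommGroup M] [Module ℂ M] [TopologicalSpace M] [IsTopologicalAddGroup M]
  [ContinuousSMul ℂ M] [T2Space M]
  [NormedAddCommGroup H₀] [InnerProductSpace ℂ H₀] [CompleteSpace H₀]
  [NormedAddCommGroup H₁] [InnerProductSpace ℂ H₁] [CompleteSpace H₁]
  [AddCommGroup N] [Module ℂ N] [TopologicalSpace N] [IsTopologicalAddGroup N]
  [ContinuousSMul ℂ N] [T2Space N]
  [NormedAddCommGroup K₀] [InnerProductSpace ℂ K₀] [CompleteSpace K₀]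
  [NormedAddCommGroup K₁] [InnerProductSpace ℂ K₁] [CompleteSpace K₁]

/-- A couple map: a linear map between the sums whose restriction to the `i`-th space is a bounded
operator `mapᵢ` into the `i`-th space, for `i = 0, 1`. -/
structure CoupleMap (C : HilbertCouple M H₀ H₁) (D : HilbertCouple N K₀ K₁) where
  toLinearMap : C.sum →ₗ[ℂ] D.sum
  map₀ : H₀ →L[ℂ] K₀
  map₁ : H₁ →L[ℂ] K₁
  restrict₀ : ∀ u : H₀, (toLinearMap ⟨C.emb₀ u, C.emb₀_mem_sum u⟩ : N) = D.emb₀ (map₀ u)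
  restrict₁ : ∀ v : H₁, (toLinearMap ⟨C.emb₁ v, C.emb₁_mem_sum v⟩ : N) = D.emb₁ (map₁ v)

/-- The norm of a couple map, `max {‖T‖_{H₀ → K₀}, ‖T‖_{H₁ → K₁}}`. -/
def CoupleMap.opNorm {C : HilbertCouple M H₀ H₁} {D : HilbertCouple N K₀ K₁}
    (T : CoupleMap C D) : ℝ :=
  max ‖T.map₀‖ ‖T.map₁‖

/-- The relative (exact) K-property of the pair of couples `C, D`: whenever `x ∈ Σ(D)` and
`y ∈ Σ(C)` satisfy `K(t, y; C) ≤ K(t, x; D)` for all `t > 0`, there is a contraction from `D` to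
`C` that maps `x` to `y`. -/
def RelativeKProperty (C : HilbertCouple M H₀ H₁) (D : HilbertCouple N K₀ K₁) : Prop :=
  ∀ (x : D.sum) (y : C.sum), (∀ t : ℝ, 0 < t → C.K t (y : M) ≤ D.K t (x : N)) →
    ∃ T : CoupleMap D C, T.toLinearMap x = y ∧ T.opNorm ≤ 1

/-- The K-property of a couple. -/
def KProperty (C : HilbertCouple M H₀ H₁) : Prop :=
  RelativeKProperty C C

end CoupleMap

end HilbertCouple

/-- The space `ℓ₂ⁿ(w)` with positive weights: `ℂⁿ` with `‖x‖² = ∑ wᵢ |xᵢ|²`. -/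
def WeightedEll2 {n : ℕ} (_w : Fin n → {r : ℝ // 0 < r}) : Type :=
  Fin n → ℂ

namespace WeightedEll2

variable {n : ℕ} (w : Fin n → {r : ℝ // 0 < r})

instance : AddCommGroup (WeightedEll2 w) := inferInstanceAs (AddCommGroup (Fin n → ℂ))

instance : Module ℂ (WeightedEll2 w) := inferInstanceAs (Module ℂ (Fin n → ℂ))

instance : FiniteDimensional ℂ (WeightedEll2 w) :=
  inferInstanceAs (FiniteDimensional ℂ (Fin n → ℂ))

/-- The identity map from `ℂⁿ` to `ℓ₂ⁿ(w)`. -/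
def ofVec : (Fin n → ℂ) ≃ₗ[ℂ] WeightedEll2 w := LinearEquiv.refl ℂ (Fin n → ℂ)

/-- The inner product `⟨x, y⟩ = ∑ wᵢ conj(xᵢ) yᵢ`. -/
abbrev core : InnerProductSpace.Core ℂ (WeightedEll2 w) where
  inner x y := ∑ i, ((w i : ℝ) : ℂ) * (conj ((ofVec w).symm x i) * (ofVec w).symm y i)
  conj_inner_symm x y := by
    simp only [map_sum, map_mul, Complex.conj_ofReal, Complex.conj_conj]
    exact Finset.sum_congr rfl fun i _ => by ring
  re_inner_nonneg x := by
    simp only [← Complex.normSq_eq_conj_mul_self, ← Complex.ofReal_mul, ← Complex.ofReal_sum]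
    exact Finset.sum_nonneg (s := Finset.univ)
      fun i _ => mul_nonneg (w i).2.le (Complex.normSq_nonneg ((ofVec w).symm x i))
  add_left x y z := by
    simp only [map_add, Pi.add_apply, ← Finset.sum_add_distrib]
    exact Finset.sum_congr rfl fun i _ => by ring
  smul_left x y r := by
    simp only [map_smul, Pi.smul_apply, smul_eq_mul, map_mul, Finset.mul_sum]
    exact Finset.sum_congr rfl fun i _ => by ring
  definite x hx := by
    simp only [← Complex.normSq_eq_conj_mul_self, ← Complex.ofReal_mul, ← Complex.ofReal_sum]
      at hx
    have h := (Finset.sum_eq_zero_iff_of_nonneg fun i _ =>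
      mul_nonneg (w i).2.le (Complex.normSq_nonneg _)).1 (Complex.ofReal_eq_zero.1 hx)
    apply (ofVec w).symm.injective
    funext i
    have hi := h i (Finset.mem_univ i)
    rcases mul_eq_zero.1 hi with h0 | h0
    · exact absurd h0 (w i).2.ne'
    · simpa using Complex.normSq_eq_zero.1 h0

instance : NormedAddCommGroup (WeightedEll2 w) := (core w).toNormedAddCommGroup

instance : InnerProductSpace ℂ (WeightedEll2 w) := InnerProductSpace.ofCore (core w).toCore

instance : CompleteSpace (WeightedEll2 w) := FiniteDimensional.complete ℂ _

/-- The squared norm of `ℓ₂ⁿ(w)` is `∑ wᵢ |xᵢ|²`. -/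
theorem norm_sq_ofVec (x : Fin n → ℂ) : ‖ofVec w x‖ ^ 2 = ∑ i, (w i : ℝ) * ‖x i‖ ^ 2 := by
  rw [@norm_sq_eq_re_inner ℂ]
  change (∑ i, ((w i : ℝ) : ℂ) * (conj (x i) * x i)).re = _
  simp only [← Complex.normSq_eq_conj_mul_self, ← Complex.ofReal_mul, ← Complex.ofReal_sum,
    Complex.ofReal_re, Complex.normSq_eq_norm_sq]

end WeightedEll2

/-- The weighted couple `(ℓ₂ⁿ, ℓ₂ⁿ(w))`, both spaces being `ℂⁿ` as sets. -/
def weightedCouple {n : ℕ} (w : Fin n → {r : ℝ // 0 < r}) :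
    HilbertCouple (Fin n → ℂ) (EuclideanSpace ℂ (Fin n)) (WeightedEll2 w) where
  emb₀ := (EuclideanSpace.equiv (Fin n) ℂ : EuclideanSpace ℂ (Fin n) →L[ℂ] (Fin n → ℂ))
  emb₁ := LinearMap.toContinuousLinearMap
    ((WeightedEll2.ofVec w).symm : WeightedEll2 w →ₗ[ℂ] (Fin n → ℂ))
  injective_emb₀ := (EuclideanSpace.equiv (Fin n) ℂ).injective
  injective_emb₁ := (WeightedEll2.ofVec w).symm.injective

/-- The reparametrized K-functional `k_w(t, x) = K(1/t, x)` of the couple `(ℓ₂ⁿ, ℓ₂ⁿ(w))`. -/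
def weightedK {n : ℕ} (w : Fin n → {r : ℝ // 0 < r}) (t : ℝ) (x : Fin n → ℂ) : ℝ≥0∞ :=
  (weightedCouple w).K (1 / t) x

end

/-! Diagonalizing the operator of the couple reduces everything to `(ℓ₂ⁿ, ℓ₂ⁿ(w))`, where domination
of the K-functionals reads `∑ wᵢ/(t+wᵢ) |yᵢ|² ≤ ∑ wᵢ/(t+wᵢ) |xᵢ|²` for all `t > 0`. The required
matrix is then obtained by duality (`exists_matrix_contraction`).

The pairs of functions dominating `(‖Tv‖₀², ‖Tv‖₁²)` for some `T` with `Tx = y` form a closed convex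
set that is stable under adding nonnegative functions. If the pair `(‖v‖₀², ‖v‖₁²)` lies outside it,
Hahn–Banach separates it by a positive functional. Applied to the pair of a matrix with rows `tᵢ`,
this functional is a cost `∑ᵢ (Q₀(tᵢ) + wᵢ Q₁(tᵢ))` with nonnegative quadratic forms `Q₀`, `Q₁`,
made positive definite by a small perturbation.

The constraints `tᵢ · x = yᵢ` decouple, so the least cost is `∑ |yᵢ|² H(wᵢ)` with `H(l) = min {Q₀(r)
+ l Q₁(r) : r · x = 1}`. By `exists_pick_representation`, `H` is a nonnegative combination of `1`,
`l` and functions `l/(s+l)` with `s > 0`, so the hypothesis gives `∑ |yᵢ|² H(wᵢ) ≤ ∑ |xᵢ|² H(wᵢ)`.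
Since `eᵢ/xᵢ` competes in the minimum whenever `xᵢ ≠ 0`, the right side is at most the cost of the
identity (`exists_matrix_cost_le`). This contradicts the separation. -/

/-! ### Quadratic forms and Pick functions. -/

/-- Two positive definite real bilinear forms on a finite-dimensional space can be diagonalized
simultaneously. -/
theorem exists_basis_simultaneously_diagonal {W : Type*} [AddCommGroup W] [Module ℝ W]
    [FiniteDimensional ℝ W] (B₀ B₁ : LinearMap.BilinForm ℝ W)
    (h₀ : ∀ u v, B₀ u v = B₀ v u) (h₁ : ∀ u v, B₁ u v = B₁ v u)
    (p₀ : ∀ v, v ≠ 0 → 0 < B₀ v v) (p₁ : ∀ v, v ≠ 0 → 0 < B₁ v v) :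
    ∃ (b : Module.Basis (Fin (Module.finrank ℝ W)) ℝ W) (m : Fin (Module.finrank ℝ W) → ℝ),
      (∀ i, 0 < m i) ∧ (∀ i j, B₀ (b i) (b j) = if i = j then 1 else 0) ∧
        ∀ i j, B₁ (b i) (b j) = if i = j then m i else 0 := by
  let core : InnerProductSpace.Core ℝ W :=
    { inner := fun u v => B₀ u v
      conj_inner_symm := fun u v => by simp [h₀ u v]
      re_inner_nonneg := fun v => by
        rcases eq_or_ne v 0 with rfl | hv
        · simp
        · simpa using (p₀ v hv).le
      add_left := fun u v w => by simp
      smul_left := fun u v r => by simp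
      definite := fun v hv => by
        by_contra hne
        exact (p₀ v hne).ne' hv }
  let : NormedAddCommGroup W := core.toNormedAddCommGroup
  let : InnerProductSpace ℝ W := InnerProductSpace.ofCore core.toCore
  have inner_eq : ∀ u v : W, inner ℝ u v = B₀ u v := fun _ _ => rfl
  have hnd : B₀.Nondegenerate := by
    refine ⟨fun v hv => ?_, fun v hv => ?_⟩ <;>
    · by_contra hne
      exact (p₀ v hne).ne' (hv v)
  -- With `B₀` as inner product, `A` represents `B₁` and is symmetric; its orthonormal eigenbasis is
  -- the basis sought.
  let A : W →ₗ[ℝ] W := B₁.symmCompOfNondegenerate B₀ hnd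
  have hA : ∀ u v, B₀ (A u) v = B₁ u v := fun u v => by
    rw [LinearMap.BilinForm.symmCompOfNondegenerate_left_apply, h₁]
  have hsymm : A.IsSymmetric := fun u v => by
    rw [inner_eq, inner_eq, hA, h₀, hA, h₁]
  have horth : ∀ i j, B₀ (hsymm.eigenvectorBasis rfl i) (hsymm.eigenvectorBasis rfl j) =
      if i = j then 1 else 0 := fun i j => by
    rw [← inner_eq, orthonormal_iff_ite.1 (hsymm.eigenvectorBasis rfl).orthonormal]
  have hdiag : ∀ i j, B₁ (hsymm.eigenvectorBasis rfl i) (hsymm.eigenvectorBasis rfl j) =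
      if i = j then hsymm.eigenvalues rfl i else 0 := fun i j => by
    rw [← hA, hsymm.apply_eigenvectorBasis]
    simp [horth]
  refine ⟨(hsymm.eigenvectorBasis rfl).toBasis, hsymm.eigenvalues rfl, fun i => ?_, ?_, ?_⟩
  · have := p₁ _ ((hsymm.eigenvectorBasis rfl).orthonormal.ne_zero i)
    rwa [hdiag, if_pos rfl] at this
  · simpa using horth
  · simpa using hdiag

/-- The function `l ↦ min {B₀ r r + l B₁ r r : r ∈ r₀ + W}` is a positive Pick function of the form
`a + b l + ∑ₖ gₖ l mₖ / (1 + l mₖ)`. -/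
theorem exists_pick_representation {V : Type*} [AddCommGroup V] [Module ℝ V]
    [FiniteDimensional ℝ V] (B₀ B₁ : LinearMap.BilinForm ℝ V)
    (h₀ : ∀ u v, B₀ u v = B₀ v u) (h₁ : ∀ u v, B₁ u v = B₁ v u)
    (p₀ : ∀ v, v ≠ 0 → 0 < B₀ v v) (p₁ : ∀ v, v ≠ 0 → 0 < B₁ v v)
    (W : Submodule ℝ V) (r₀ : V) :
    ∃ (N : ℕ) (a b : ℝ) (g m : Fin N → ℝ), 0 ≤ a ∧ 0 ≤ b ∧ (∀ k, 0 ≤ g k) ∧ (∀ k, 0 < m k) ∧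
      ∀ l : ℝ, 0 ≤ l →
        (∃ s ∈ W, B₀ (r₀ + s) (r₀ + s) + l * B₁ (r₀ + s) (r₀ + s) =
          a + b * l + ∑ k, g k * (l * m k / (1 + l * m k))) ∧
        ∀ s ∈ W, a + b * l + ∑ k, g k * (l * m k / (1 + l * m k)) ≤
          B₀ (r₀ + s) (r₀ + s) + l * B₁ (r₀ + s) (r₀ + s) := by
  obtain ⟨b, m, hm, hb₀, hb₁⟩ := exists_basis_simultaneously_diagonal (B₀.restrict W)
    (B₁.restrict W) (fun u v => h₀ u v) (fun u v => h₁ u v)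
    (fun v hv => p₀ v (by simpa using hv)) (fun v hv => p₁ v (by simpa using hv))
  set u : Fin (Module.finrank ℝ W) → ℝ := fun k => B₀ r₀ (b k)
  set v : Fin (Module.finrank ℝ W) → ℝ := fun k => B₁ r₀ (b k)
  have nonneg : ∀ (B : LinearMap.BilinForm ℝ V), (∀ v, v ≠ 0 → 0 < B v v) → ∀ v, 0 ≤ B v v := by
    intro B hB v
    rcases eq_or_ne v 0 with rfl | hv
    · simp
    · exact (hB v hv).le
  have expand : ∀ (B : LinearMap.BilinForm ℝ V) (_ : ∀ u v, B u v = B v u)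
      (d : Fin (Module.finrank ℝ W) → ℝ)
      (_ : ∀ i j, B.restrict W (b i) (b j) = if i = j then d i else 0)
      (c : Fin (Module.finrank ℝ W) → ℝ),
      B (r₀ + ((∑ k, c k • b k : W) : V)) (r₀ + ((∑ k, c k • b k : W) : V)) =
        B r₀ r₀ + ∑ k, (2 * c k * B r₀ (b k) + d k * c k ^ 2) := by
    intro B hB d hd c
    have e1 : B r₀ ((∑ k, c k • b k : W) : V) = ∑ k, c k * B r₀ (b k) := by simp
    have e2 : B ((∑ k, c k • b k : W) : V) ((∑ k, c k • b k : W) : V) = ∑ k, d k * c k ^ 2 := by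
      have : B.restrict W (∑ k, c k • b k) (∑ k, c k • b k) = ∑ k, d k * c k ^ 2 := by
        simp only [map_sum, LinearMap.sum_apply, map_smul, LinearMap.smul_apply, hd, smul_eq_mul]
        simp only [mul_ite, mul_zero, Finset.sum_ite_eq', Finset.mem_univ,
          if_true]
        exact Finset.sum_congr rfl fun k _ => by ring
      exact this
    rw [map_add, map_add, LinearMap.add_apply, LinearMap.add_apply,
      hB ((∑ k, c k • b k : W) : V) r₀, e1, e2, Finset.sum_add_distrib]
    have : ∑ k, 2 * c k * B r₀ (b k) = 2 * ∑ k, c k * B r₀ (b k) := by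
      rw [Finset.mul_sum]; exact Finset.sum_congr rfl fun k _ => by ring
    rw [this]; ring
  -- Completing the square in each coordinate `c k` leaves `-(u + l v)² / (1 + l m)`, which equals
  -- `-u² - l v²/m + (u - v/m)² l m / (1 + l m)`; this dictates `g`, `a` and `β`.
  set g : Fin (Module.finrank ℝ W) → ℝ := fun k => (u k - v k / m k) ^ 2
  set a : ℝ := B₀ r₀ r₀ - ∑ k, u k ^ 2
  set β : ℝ := B₁ r₀ r₀ - ∑ k, v k ^ 2 / m k
  have square : ∀ l : ℝ, 0 ≤ l → ∀ c : Fin (Module.finrank ℝ W) → ℝ,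
      B₀ (r₀ + ((∑ k, c k • b k : W) : V)) (r₀ + ((∑ k, c k • b k : W) : V)) +
        l * B₁ (r₀ + ((∑ k, c k • b k : W) : V)) (r₀ + ((∑ k, c k • b k : W) : V)) =
      a + β * l + ∑ k, g k * (l * m k / (1 + l * m k)) +
        ∑ k, (1 + l * m k) * (c k + (u k + l * v k) / (1 + l * m k)) ^ 2 := by
    intro l hl c
    rw [expand B₀ h₀ (fun _ => 1) hb₀, expand B₁ h₁ m hb₁]
    simp only [a, β, sub_mul, Finset.sum_mul, mul_add, Finset.mul_sum]
    have key : ∀ k, (2 * c k * u k + 1 * c k ^ 2) + l * (2 * c k * v k + m k * c k ^ 2) =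
        - u k ^ 2 - v k ^ 2 / m k * l + g k * (l * m k / (1 + l * m k)) +
          (1 + l * m k) * (c k + (u k + l * v k) / (1 + l * m k)) ^ 2 := by
      intro k
      have h1 : m k ≠ 0 := (hm k).ne'
      have h2 : 1 + l * m k ≠ 0 := by have := mul_nonneg hl (hm k).le; positivity
      simp only [g]
      field_simp
      ring
    have := Finset.sum_congr rfl fun k (_ : k ∈ Finset.univ) => key k
    simp only [Finset.sum_add_distrib, Finset.sum_sub_distrib, Finset.sum_neg_distrib] at this
    simp only [mul_add, Finset.sum_add_distrib] at this ⊢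
    linarith
  have attained : ∀ l : ℝ, 0 ≤ l → ∃ s ∈ W, B₀ (r₀ + s) (r₀ + s) + l * B₁ (r₀ + s) (r₀ + s) =
      a + β * l + ∑ k, g k * (l * m k / (1 + l * m k)) := by
    intro l hl
    refine ⟨_, (∑ k, (-((u k + l * v k) / (1 + l * m k))) • b k : W).2, ?_⟩
    rw [square l hl]
    simp
  have hg : ∀ k, 0 ≤ g k := fun k => sq_nonneg _
  have hpos : ∀ l : ℝ, 0 ≤ l → 0 ≤ a + β * l + ∑ k, g k * (l * m k / (1 + l * m k)) := by
    intro l hl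
    obtain ⟨s, -, hs⟩ := attained l hl
    rw [← hs]
    exact add_nonneg (nonneg B₀ p₀ _) (mul_nonneg hl (nonneg B₁ p₁ _))
  refine ⟨_, a, β, g, m, by simpa using hpos 0 le_rfl, ?_, hg, hm, fun l hl => ⟨attained l hl, ?_⟩⟩
  -- The sum over `k` is bounded by `∑ g k`, so a negative slope would make the nonnegative minimum
  -- negative for large `l`; the `l` used below brings the bound to exactly `-1`.
  · by_contra! hneg
    have hbound : ∀ l : ℝ, 0 ≤ l → 0 ≤ a + β * l + ∑ k, g k := by
      intro l hl
      refine (hpos l hl).trans (add_le_add le_rfl (Finset.sum_le_sum fun k _ => ?_))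
      have := mul_nonneg hl (hm k).le
      exact mul_le_of_le_one_right (hg k) ((div_le_one (by positivity)).2 (by linarith))
    have ha : 0 ≤ a + ∑ k, g k := by simpa using hbound 0 le_rfl
    have := hbound ((a + ∑ k, g k + 1) / (-β)) (by
      apply div_nonneg <;> linarith)
    have e : β * ((a + ∑ k, g k + 1) / (-β)) = -(a + ∑ k, g k + 1) := by
      field_simp [hneg.ne]
    linarith
  · intro s hs
    have e : s = ((∑ k, b.repr ⟨s, hs⟩ k • b k : W) : V) := by rw [b.sum_repr]
    rw [e, square l hl]
    refine le_add_of_nonneg_right (Finset.sum_nonneg fun k _ => ?_)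
    have := mul_nonneg hl (hm k).le
    positivity

/-! ### The closed convex set of dominating pairs. -/

section Feasible

open Filter Topology

/-- The squared modulus of the linear functional with coefficient vector `t`. -/
noncomputable def rowSq {n : ℕ} (t v : Fin n → ℂ) : ℝ := ‖t ⬝ᵥ v‖ ^ 2

/-- Pairs of functions that dominate `‖T v‖²` and `‖T v‖²_w` for some matrix `T`, given by its
rows, that maps `x` to `y`. -/
noncomputable def dominatingPairs {n : ℕ} (w : Fin n → ℝ) (x y : Fin n → ℂ) :
    Set (((Fin n → ℂ) → ℝ) × ((Fin n → ℂ) → ℝ)) :=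
  {p | ∃ T : Fin n → Fin n → ℂ, (∀ i, T i ⬝ᵥ x = y i) ∧
    (∀ v, ∑ i, rowSq (T i) v ≤ p.1 v) ∧ ∀ v, ∑ i, w i * rowSq (T i) v ≤ p.2 v}

theorem rowSq_nonneg {n : ℕ} (t v : Fin n → ℂ) : 0 ≤ rowSq t v := sq_nonneg _

theorem rowSq_single {n : ℕ} (t : Fin n → ℂ) (j : Fin n) :
    rowSq t (Pi.single j 1) = ‖t j‖ ^ 2 := by
  simp [rowSq]

theorem rowSq_single_left {n : ℕ} (v : Fin n → ℂ) (j : Fin n) :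
    rowSq (Pi.single j 1) v = ‖v j‖ ^ 2 := by
  simp [rowSq]

theorem rowSq_smul {n : ℕ} (c : ℂ) (t : Fin n → ℂ) :
    rowSq (c • t) = ‖c‖ ^ 2 • rowSq t := by
  funext v
  simp [rowSq, smul_dotProduct, mul_pow]

theorem rowSq_convex {n : ℕ} (s t v : Fin n → ℂ) {a b : ℝ} (ha : 0 ≤ a) (hb : 0 ≤ b)
    (hab : a + b = 1) : rowSq (a • s + b • t) v ≤ a * rowSq s v + b * rowSq t v := by
  have h : ‖(a • s + b • t) ⬝ᵥ v‖ ≤ a * ‖s ⬝ᵥ v‖ + b * ‖t ⬝ᵥ v‖ := by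
    rw [add_dotProduct, smul_dotProduct, smul_dotProduct]
    refine (norm_add_le _ _).trans ?_
    rw [norm_smul, norm_smul, Real.norm_of_nonneg ha, Real.norm_of_nonneg hb]
  refine (pow_le_pow_left₀ (norm_nonneg _) h 2).trans ?_
  simp only [rowSq]
  obtain rfl : b = 1 - a := by linarith
  nlinarith [mul_nonneg (mul_nonneg ha hb) (sq_nonneg (‖s ⬝ᵥ v‖ - ‖t ⬝ᵥ v‖))]

theorem convex_dominatingPairs {n : ℕ} {w : Fin n → ℝ} (hw : ∀ i, 0 < w i) (x y : Fin n → ℂ) :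
    Convex ℝ (dominatingPairs w x y) := by
  rintro p ⟨S, hS, hS₀, hS₁⟩ q ⟨T, hT, hT₀, hT₁⟩ a b ha hb hab
  refine ⟨a • S + b • T, fun i => ?_, fun v => ?_, fun v => ?_⟩
  · rw [Pi.add_apply, Pi.smul_apply, Pi.smul_apply, add_dotProduct, smul_dotProduct,
      smul_dotProduct, hS, hT, ← add_smul, hab, one_smul]
  · calc ∑ i, rowSq ((a • S + b • T) i) v
        ≤ ∑ i, (a * rowSq (S i) v + b * rowSq (T i) v) :=
          Finset.sum_le_sum fun i _ => rowSq_convex (S i) (T i) v ha hb hab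
      _ = a * ∑ i, rowSq (S i) v + b * ∑ i, rowSq (T i) v := by
          rw [Finset.sum_add_distrib, Finset.mul_sum, Finset.mul_sum]
      _ ≤ _ := add_le_add (mul_le_mul_of_nonneg_left (hS₀ v) ha)
          (mul_le_mul_of_nonneg_left (hT₀ v) hb)
  · calc ∑ i, w i * rowSq ((a • S + b • T) i) v
        ≤ ∑ i, (a * (w i * rowSq (S i) v) + b * (w i * rowSq (T i) v)) :=
          Finset.sum_le_sum fun i _ => by
            have := mul_le_mul_of_nonneg_left (rowSq_convex (S i) (T i) v ha hb hab) (hw i).le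
            refine this.trans (le_of_eq ?_)
            ring
      _ = a * ∑ i, w i * rowSq (S i) v + b * ∑ i, w i * rowSq (T i) v := by
          rw [Finset.sum_add_distrib, Finset.mul_sum, Finset.mul_sum]
      _ ≤ _ := add_le_add (mul_le_mul_of_nonneg_left (hS₁ v) ha)
          (mul_le_mul_of_nonneg_left (hT₁ v) hb)

/-- Near a limit point, the values of the first function at the basis vectors are bounded, and these
bound the entries of `T`. So locally the set is the projection of a closed set along a compact ball
of matrices. -/
theorem isClosed_dominatingPairs {n : ℕ} (w : Fin n → ℝ) (x y : Fin n → ℂ) :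
    IsClosed (dominatingPairs w x y) := by
  refine isClosed_of_closure_subset fun p hp => ?_
  -- The final `+ 1` gives `R ≥ 1`, so that `‖T i j‖ ^ 2 ≤ R` forces `‖T i j‖ ≤ R`.
  set R : ℝ := ∑ j : Fin n, (|p.1 (Pi.single j 1)| + 1) + 1
  have hterm : ∀ j ∈ Finset.univ, 0 ≤ |p.1 (Pi.single j 1)| + 1 := fun j _ => by positivity
  have hR : 1 ≤ R := le_add_of_nonneg_left (Finset.sum_nonneg hterm)
  let U : Set (((Fin n → ℂ) → ℝ) × ((Fin n → ℂ) → ℝ)) :=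
    {q | ∀ j, q.1 (Pi.single j 1) < p.1 (Pi.single j 1) + 1}
  have hU : IsOpen U := by
    simp only [U, Set.ofPred_forall]
    exact isOpen_iInter_of_finite fun j => isOpen_lt (by fun_prop) continuous_const
  let B := Metric.closedBall (0 : Fin n → Fin n → ℂ) R
  have : CompactSpace B := isCompact_iff_compactSpace.1 (isCompact_closedBall _ _)
  let Z : Set (B × (((Fin n → ℂ) → ℝ) × ((Fin n → ℂ) → ℝ))) :=
    {z | (∀ i, z.1.1 i ⬝ᵥ x = y i) ∧
    (∀ v, ∑ i, rowSq (z.1.1 i) v ≤ z.2.1 v) ∧ ∀ v, ∑ i, w i * rowSq (z.1.1 i) v ≤ z.2.2 v}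
  have hZ : IsClosed Z := by
    have hc : ∀ i v, Continuous fun z : B × (((Fin n → ℂ) → ℝ) × ((Fin n → ℂ) → ℝ)) =>
        z.1.1 i ⬝ᵥ v := by
      intro i v
      have : Continuous fun S : Fin n → Fin n → ℂ => S i ⬝ᵥ v := by
        simp only [dotProduct]
        fun_prop
      exact this.comp (continuous_subtype_val.comp continuous_fst)
    simp only [Z, Set.ofPred_and, Set.ofPred_forall, rowSq]
    refine IsClosed.inter ?_ (IsClosed.inter ?_ ?_)
    · exact isClosed_iInter fun i => isClosed_eq (hc i x) continuous_const
    · exact isClosed_iInter fun v => isClosed_le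
        (continuous_finsetSum _ fun i _ => (hc i v).norm.pow 2) (by fun_prop)
    · exact isClosed_iInter fun v => isClosed_le
        (continuous_finsetSum _ fun i _ => ((hc i v).norm.pow 2).const_mul _) (by fun_prop)
  have himage : IsClosed (Prod.snd '' Z) := isClosedMap_snd_of_compactSpace _ hZ
  have hsub : U ∩ dominatingPairs w x y ⊆ Prod.snd '' Z := by
    rintro q ⟨hq, T, hT, hT₀, hT₁⟩
    refine ⟨(⟨T, ?_⟩, q), ⟨hT, hT₀, hT₁⟩, rfl⟩
    have hR₀ : 0 ≤ R := by linarith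
    rw [mem_closedBall_zero_iff, pi_norm_le_iff_of_nonneg hR₀]
    intro i
    rw [pi_norm_le_iff_of_nonneg hR₀]
    intro j
    have h1 : ‖T i j‖ ^ 2 ≤ R := by
      rw [← rowSq_single]
      have h2 := Finset.single_le_sum (f := fun i => rowSq (T i) (Pi.single j 1))
        (fun i _ => rowSq_nonneg _ _) (Finset.mem_univ i)
      have h3 := Finset.single_le_sum hterm (Finset.mem_univ j)
      have h4 := hT₀ (Pi.single j 1)
      have h5 := hq j
      have h6 := le_abs_self (p.1 (Pi.single j 1))
      linarith
    by_contra! h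
    nlinarith
  have hmem : p ∈ closure (U ∩ dominatingPairs w x y) :=
    hU.inter_closure ⟨fun j => by linarith, hp⟩
  obtain ⟨⟨T, q⟩, ⟨hT, hT₀, hT₁⟩, hq⟩ := closure_minimal hsub himage hmem
  rw [← hq]
  exact ⟨T.1, hT, hT₀, hT₁⟩

/-- The real bilinear form `(s, t) ↦ f (v ↦ Re (conj (s ⬝ᵥ v) * (t ⬝ᵥ v)))`. -/
noncomputable def rowForm {n : ℕ} (f : ((Fin n → ℂ) → ℝ) →ₗ[ℝ] ℝ) : LinearMap.BilinForm ℝ (Fin n → ℂ) :=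
  LinearMap.mk₂ ℝ
    (fun s t => f fun v => (s ⬝ᵥ v).re * (t ⬝ᵥ v).re + (s ⬝ᵥ v).im * (t ⬝ᵥ v).im)
    (fun s s' t => by
      rw [← map_add]; congr 1; funext v
      simp only [add_dotProduct, Complex.add_re, Complex.add_im, Pi.add_apply]; ring)
    (fun c s t => by
      rw [← map_smul]; congr 1; funext v
      simp only [smul_dotProduct, Complex.smul_re, Complex.smul_im, Pi.smul_apply, smul_eq_mul]
      ring)
    (fun s t t' => by
      rw [← map_add]; congr 1; funext v
      simp only [add_dotProduct, Complex.add_re, Complex.add_im, Pi.add_apply]; ring)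
    (fun c s t => by
      rw [← map_smul]; congr 1; funext v
      simp only [smul_dotProduct, Complex.smul_re, Complex.smul_im, Pi.smul_apply, smul_eq_mul]
      ring)

theorem rowForm_self {n : ℕ} (f : ((Fin n → ℂ) → ℝ) →ₗ[ℝ] ℝ) (t : Fin n → ℂ) :
    rowForm f t t = f (rowSq t) := by
  simp only [rowForm, LinearMap.mk₂_apply]
  congr 1
  funext v
  rw [rowSq, ← Complex.normSq_eq_norm_sq, Complex.normSq_apply]

theorem rowForm_symm {n : ℕ} (f : ((Fin n → ℂ) → ℝ) →ₗ[ℝ] ℝ) (s t : Fin n → ℂ) :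
    rowForm f s t = rowForm f t s := by
  simp only [rowForm, LinearMap.mk₂_apply]
  congr 1
  funext v
  ring

/-! ### Testing the K-inequality against Pick functions. -/

/-- The limit `t → 0⁺`; it handles the constant term of the Pick function. -/
theorem sum_sq_le_of_forall_pos {n : ℕ} {w : Fin n → ℝ} (hw : ∀ i, 0 < w i) {c d : Fin n → ℝ}
    (h : ∀ t : ℝ, 0 < t → ∑ i, w i / (t + w i) * c i ≤ ∑ i, w i / (t + w i) * d i) :
    ∑ i, c i ≤ ∑ i, d i := by
  have lim : ∀ c : Fin n → ℝ,
      Tendsto (fun t : ℝ => ∑ i, w i / (t + w i) * c i) (𝓝[>] 0) (𝓝 (∑ i, c i)) := by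
    intro c
    refine tendsto_nhdsWithin_of_tendsto_nhds (tendsto_finsetSum _ fun i _ => ?_)
    have : ContinuousAt (fun t : ℝ => w i / (t + w i) * c i) 0 := by
      have : (0 : ℝ) + w i ≠ 0 := by simpa using (hw i).ne'
      fun_prop (disch := assumption)
    simpa [(hw i).ne'] using this.tendsto
  refine le_of_tendsto_of_tendsto (lim c) (lim d) ?_
  filter_upwards [self_mem_nhdsWithin] with t ht using h t ht

/-- The limit `t → ∞` after multiplication by `t`, written with `s = 1/t`; it handles the linear
term of the Pick function. -/
theorem weighted_sum_sq_le_of_forall_pos {n : ℕ} {w : Fin n → ℝ} (hw : ∀ i, 0 < w i)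
    {c d : Fin n → ℝ}
    (h : ∀ t : ℝ, 0 < t → ∑ i, w i / (t + w i) * c i ≤ ∑ i, w i / (t + w i) * d i) :
    ∑ i, w i * c i ≤ ∑ i, w i * d i := by
  have lim : ∀ c : Fin n → ℝ,
      Tendsto (fun s : ℝ => ∑ i, w i / (1 + s * w i) * c i) (𝓝[>] 0) (𝓝 (∑ i, w i * c i)) := by
    intro c
    refine tendsto_nhdsWithin_of_tendsto_nhds (tendsto_finsetSum _ fun i _ => ?_)
    have : ContinuousAt (fun s : ℝ => w i / (1 + s * w i) * c i) 0 := by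
      have : (1 : ℝ) + 0 * w i ≠ 0 := by simp
      fun_prop (disch := assumption)
    simpa using this.tendsto
  refine le_of_tendsto_of_tendsto (lim c) (lim d) ?_
  filter_upwards [self_mem_nhdsWithin] with s hs
  have hs : 0 < s := hs
  have scale : ∀ c : Fin n → ℝ,
      ∑ i, w i / (1 + s * w i) * c i = s⁻¹ * ∑ i, w i / (s⁻¹ + w i) * c i := by
    intro c
    rw [Finset.mul_sum]
    refine Finset.sum_congr rfl fun i _ => ?_
    have := hw i
    field_simp
  rw [scale, scale]
  exact mul_le_mul_of_nonneg_left (h _ (inv_pos.2 hs)) (inv_pos.2 hs).le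

/-- The dual inequality: against positive functionals, some matrix mapping `x` to `y` does not
cost more than the identity. -/
theorem exists_matrix_cost_le {n : ℕ} {w : Fin n → ℝ} (hw : ∀ i, 0 < w i) {x y : Fin n → ℂ}
    (hx : x ≠ 0)
    (h : ∀ t : ℝ, 0 < t →
      ∑ i, w i / (t + w i) * ‖y i‖ ^ 2 ≤ ∑ i, w i / (t + w i) * ‖x i‖ ^ 2)
    (f₀ f₁ : ((Fin n → ℂ) → ℝ) →ₗ[ℝ] ℝ)
    (p₀ : ∀ t : Fin n → ℂ, t ≠ 0 → 0 < f₀ (rowSq t))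
    (p₁ : ∀ t : Fin n → ℂ, t ≠ 0 → 0 < f₁ (rowSq t)) :
    ∃ T : Fin n → Fin n → ℂ, (∀ i, T i ⬝ᵥ x = y i) ∧
      ∑ i, (f₀ (rowSq (T i)) + w i * f₁ (rowSq (T i))) ≤
        ∑ i, (f₀ (rowSq (Pi.single i 1)) + w i * f₁ (rowSq (Pi.single i 1))) := by
  obtain ⟨j, hj⟩ := Function.ne_iff.1 hx
  rw [Pi.zero_apply] at hj
  let W : Submodule ℝ (Fin n → ℂ) :=
    { carrier := {t | t ⬝ᵥ x = 0}
      zero_mem' := by simp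
      add_mem' := fun {s t} hs ht => by
        simp only [Set.mem_ofPred_eq] at hs ht ⊢
        rw [add_dotProduct, hs, ht, add_zero]
      smul_mem' := fun c t ht => by
        simp only [Set.mem_ofPred_eq] at ht ⊢
        rw [smul_dotProduct, ht, smul_zero] }
  have hW : ∀ t, t ∈ W ↔ t ⬝ᵥ x = 0 := fun t => Iff.rfl
  -- A base point of the affine hyperplane `r ⬝ᵥ x = 1`, whose direction is `W`.
  set r₀ : Fin n → ℂ := Pi.single j (x j)⁻¹
  have hr₀ : r₀ ⬝ᵥ x = 1 := by simp [r₀, hj]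
  obtain ⟨N, a, b, g, m, ha, hb, hg, hm, hrep⟩ := exists_pick_representation (rowForm f₀)
    (rowForm f₁) (rowForm_symm f₀) (rowForm_symm f₁)
    (fun t ht => by rw [rowForm_self]; exact p₀ t ht)
    (fun t ht => by rw [rowForm_self]; exact p₁ t ht) W r₀
  simp only [rowForm_self] at hrep
  set H : ℝ → ℝ := fun l => a + b * l + ∑ k, g k * (l * m k / (1 + l * m k))
  choose s hsW hs using fun i => (hrep (w i) (hw i).le).1
  have cost_smul : ∀ (c : ℂ) (t : Fin n → ℂ) (l : ℝ),
      f₀ (rowSq (c • t)) + l * f₁ (rowSq (c • t)) =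
        ‖c‖ ^ 2 * (f₀ (rowSq t) + l * f₁ (rowSq t)) := by
    intro c t l
    rw [rowSq_smul, map_smul, map_smul, smul_eq_mul, smul_eq_mul]
    ring
  refine ⟨fun i => y i • (r₀ + s i), fun i => ?_, ?_⟩
  · rw [smul_dotProduct, add_dotProduct, hr₀, (hW _).1 (hsW i)]
    simp
  · have upper : ∑ i, ‖y i‖ ^ 2 * H (w i) ≤ ∑ i, ‖x i‖ ^ 2 * H (w i) := by
      -- Since `l m / (1 + l m) = l / (m⁻¹ + l)`, the `k`-th term is the K-inequality at `t = (m
      -- k)⁻¹`.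
      have expand : ∀ c : Fin n → ℝ, ∑ i, c i * H (w i) =
          a * ∑ i, c i + b * ∑ i, w i * c i +
            ∑ k, g k * ∑ i, w i / ((m k)⁻¹ + w i) * c i := by
        intro c
        simp only [Finset.mul_sum]
        rw [Finset.sum_comm, ← Finset.sum_add_distrib, ← Finset.sum_add_distrib]
        refine Finset.sum_congr rfl fun i _ => ?_
        simp only [H, mul_add, Finset.mul_sum]
        congr 1
        · ring
        · refine Finset.sum_congr rfl fun k _ => ?_
          have := hm k
          have := hw i
          field_simp
      rw [expand, expand]
      refine add_le_add (add_le_add (mul_le_mul_of_nonneg_left ?_ ha)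
        (mul_le_mul_of_nonneg_left ?_ hb))
        (Finset.sum_le_sum fun k _ => mul_le_mul_of_nonneg_left (h _ (inv_pos.2 (hm k))) (hg k))
      · exact sum_sq_le_of_forall_pos hw h
      · exact weighted_sum_sq_le_of_forall_pos hw h
    calc ∑ i, (f₀ (rowSq (y i • (r₀ + s i))) + w i * f₁ (rowSq (y i • (r₀ + s i))))
        = ∑ i, ‖y i‖ ^ 2 * H (w i) :=
          Finset.sum_congr rfl fun i _ => by rw [cost_smul, hs]
      _ ≤ ∑ i, ‖x i‖ ^ 2 * H (w i) := upper
      _ ≤ _ := Finset.sum_le_sum fun i _ => by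
          rcases eq_or_ne (x i) 0 with hxi | hxi
          · have hne : (Pi.single i 1 : Fin n → ℂ) ≠ 0 := by simp
            have := (p₀ _ hne).le
            have := mul_nonneg (hw i).le (p₁ _ hne).le
            rw [hxi]
            simp only [norm_zero, ne_eq, OfNat.ofNat_ne_zero, not_false_eq_true, zero_pow, zero_mul]
            positivity
          -- The rescaled identity row `eᵢ / xᵢ` lies in the hyperplane, so its cost is at least `H
          -- (w i)`.
          · have hmem : Pi.single i (x i)⁻¹ - r₀ ∈ W := by
              rw [hW, sub_dotProduct, hr₀]
              simp [hxi]
            have hle := (hrep (w i) (hw i).le).2 _ hmem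
            rw [add_sub_cancel] at hle
            have e : (Pi.single i 1 : Fin n → ℂ) = x i • Pi.single i (x i)⁻¹ := by
              rw [← Pi.single_smul, smul_eq_mul, mul_inv_cancel₀ hxi]
            rw [e, cost_smul]
            exact mul_le_mul_of_nonneg_left hle (sq_nonneg _)

/-! ### Existence of the contraction by separation. -/

/-- A matrix that maps `x` to `y` and is a contraction for both norms exists as soon as the
`K`-functional of `y` is dominated by that of `x`. -/
theorem exists_matrix_contraction {n : ℕ} {w : Fin n → ℝ} (hw : ∀ i, 0 < w i) {x y : Fin n → ℂ}
    (h : ∀ t : ℝ, 0 < t →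
      ∑ i, w i / (t + w i) * ‖y i‖ ^ 2 ≤ ∑ i, w i / (t + w i) * ‖x i‖ ^ 2) :
    ∃ T : Matrix (Fin n) (Fin n) ℂ, T *ᵥ x = y ∧
      (∀ v, ∑ i, ‖(T *ᵥ v) i‖ ^ 2 ≤ ∑ i, ‖v i‖ ^ 2) ∧
      ∀ v, ∑ i, w i * ‖(T *ᵥ v) i‖ ^ 2 ≤ ∑ i, w i * ‖v i‖ ^ 2 := by
  rcases eq_or_ne x 0 with rfl | hx
  · have hy : y = 0 := by
      have h1 := sum_sq_le_of_forall_pos hw h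
      simp only [Pi.zero_apply, norm_zero, ne_eq, OfNat.ofNat_ne_zero, not_false_eq_true, zero_pow,
        Finset.sum_const_zero] at h1
      have h2 := (Finset.sum_eq_zero_iff_of_nonneg fun i _ => sq_nonneg ‖y i‖).1
        (h1.antisymm (Finset.sum_nonneg fun i _ => sq_nonneg _))
      funext i
      simpa using h2 i (Finset.mem_univ i)
    refine ⟨0, by simp [hy], fun v => ?_, fun v => ?_⟩
    · simpa using Finset.sum_nonneg fun i _ => sq_nonneg ‖v i‖
    · simpa using Finset.sum_nonneg fun i _ => mul_nonneg (hw i).le (sq_nonneg ‖v i‖)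
  set α : (Fin n → ℂ) → ℝ := ∑ i, rowSq (Pi.single i 1)
  set β : (Fin n → ℂ) → ℝ := ∑ i, w i • rowSq (Pi.single i 1)
  have hα : ∀ v, α v = ∑ i, ‖v i‖ ^ 2 := fun v => by
    simp [α, Finset.sum_apply, rowSq_single_left]
  have hβ : ∀ v, β v = ∑ i, w i * ‖v i‖ ^ 2 := fun v => by
    simp [β, Finset.sum_apply, rowSq_single_left]
  suffices hmem : (α, β) ∈ dominatingPairs w x y by
    obtain ⟨T, hT, hT₀, hT₁⟩ := hmem
    refine ⟨Matrix.of T, funext hT, fun v => ?_, fun v => ?_⟩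
    · rw [← hα v]; exact hT₀ v
    · rw [← hβ v]; exact hT₁ v
  by_contra hnot
  obtain ⟨f, u, hfu, huf⟩ := geometric_hahn_banach_point_closed (convex_dominatingPairs hw x y)
    (isClosed_dominatingPairs w x y) hnot
  let φ₀ : ((Fin n → ℂ) → ℝ) →ₗ[ℝ] ℝ := f.toLinearMap ∘ₗ LinearMap.inl ℝ _ _
  let φ₁ : ((Fin n → ℂ) → ℝ) →ₗ[ℝ] ℝ := f.toLinearMap ∘ₗ LinearMap.inr ℝ _ _
  have hf : ∀ p, f p = φ₀ p.1 + φ₁ p.2 := fun p => by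
    have : p = (p.1, 0) + (0, p.2) := by simp
    conv_lhs => rw [this, map_add]
    rfl
  have hcost : ∀ T : Fin n → Fin n → ℂ, f (∑ i, rowSq (T i), ∑ i, w i • rowSq (T i)) =
      ∑ i, (φ₀ (rowSq (T i)) + w i * φ₁ (rowSq (T i))) := fun T => by
    rw [hf, Finset.sum_add_distrib]
    simp only [map_sum, map_smul, smul_eq_mul]
  have hfeas : ∀ T : Fin n → Fin n → ℂ, (∀ i, T i ⬝ᵥ x = y i) → ∀ c,
      0 ≤ c → u < f ((∑ i, rowSq (T i), ∑ i, w i • rowSq (T i)) + c) := by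
    intro T hT c hc
    refine huf _ ⟨T, hT, fun v => ?_, fun v => ?_⟩
    · simpa [Finset.sum_apply] using hc.1 v
    · simpa [Finset.sum_apply] using hc.2 v
  -- Starting from one feasible matrix `T₀`, adding large multiples of `c` stays in the set; if `f c
  -- < 0` this would push `f` below `u`.
  have hpos : ∀ c, 0 ≤ c → 0 ≤ f c := by
    intro c hc
    by_contra! hneg
    obtain ⟨j, hj⟩ := Function.ne_iff.1 hx
    rw [Pi.zero_apply] at hj
    set T₀ : Fin n → Fin n → ℂ := fun i => Pi.single j (y i / x j)
    set F := f (∑ i, rowSq (T₀ i), ∑ i, w i • rowSq (T₀ i))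
    have h1 : ∀ r : ℝ, 0 ≤ r → u < F + r * f c := fun r hr => by
      have := hfeas T₀ (fun i => by simp [T₀, hj]) (r • c) (smul_nonneg hr hc)
      rwa [map_add, map_smul, smul_eq_mul] at this
    have h2 := h1 0 le_rfl
    have h3 := h1 ((F - u) / (-f c)) (by apply div_nonneg <;> linarith)
    have e : (F - u) / (-f c) * f c = -(F - u) := by field_simp [hneg.ne]
    linarith
  -- The separating functional is only nonnegative on the functions `rowSq t`; adding `ε • E` makes
  -- it strictly positive there for `t ≠ 0`.
  set E : ((Fin n → ℂ) → ℝ) →ₗ[ℝ] ℝ := ∑ j : Fin n, LinearMap.proj (Pi.single j 1)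
  have hE : ∀ t, E (rowSq t) = ∑ j, ‖t j‖ ^ 2 := fun t => by
    simp [E, LinearMap.sum_apply, rowSq_single]
  have hE_nonneg : ∀ t, 0 ≤ E (rowSq t) := fun t => by
    rw [hE]; exact Finset.sum_nonneg fun _ _ => sq_nonneg _
  have hE_pos : ∀ t, t ≠ 0 → 0 < E (rowSq t) := fun t ht => by
    obtain ⟨j, hj⟩ := Function.ne_iff.1 ht
    rw [hE]
    exact Finset.sum_pos' (fun _ _ => sq_nonneg _)
      ⟨j, Finset.mem_univ j, by have := norm_pos_iff.2 hj; positivity⟩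
  have hφ₀ : ∀ t, 0 ≤ φ₀ (rowSq t) := fun t => hpos _ ⟨fun v => rowSq_nonneg t v, le_rfl⟩
  have hφ₁ : ∀ t, 0 ≤ φ₁ (rowSq t) := fun t => hpos _ ⟨le_rfl, fun v => rowSq_nonneg t v⟩
  set κ : ℝ := ∑ i : Fin n, (1 + w i) * E (rowSq (Pi.single i 1))
  have hκ : 0 ≤ κ := Finset.sum_nonneg fun i _ =>
    mul_nonneg (by have := hw i; positivity) (hE_nonneg _)
  -- Here `κ` is the extra cost of the identity per unit of `ε`; this `ε` keeps it below the
  -- separation gap.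
  set ε : ℝ := (u - f (α, β)) / (κ + 1)
  have hε : 0 < ε := div_pos (by linarith) (by linarith)
  have hεκ : ε * κ < u - f (α, β) := by
    have : ε * (κ + 1) = u - f (α, β) := div_mul_cancel₀ _ (by linarith)
    linarith
  obtain ⟨T, hT, hle⟩ := exists_matrix_cost_le hw hx h (φ₀ + ε • E) (φ₁ + ε • E)
    (fun t ht => add_pos_of_nonneg_of_pos (hφ₀ t) (mul_pos hε (hE_pos t ht)))
    (fun t ht => add_pos_of_nonneg_of_pos (hφ₁ t) (mul_pos hε (hE_pos t ht)))
  have hsplit : ∀ S : Fin n → Fin n → ℂ,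
      ∑ i, ((φ₀ + ε • E) (rowSq (S i)) + w i * (φ₁ + ε • E) (rowSq (S i))) =
        f (∑ i, rowSq (S i), ∑ i, w i • rowSq (S i)) +
          ε * ∑ i, (1 + w i) * E (rowSq (S i)) := by
    intro S
    rw [hcost, Finset.mul_sum, ← Finset.sum_add_distrib]
    refine Finset.sum_congr rfl fun i _ => ?_
    simp only [LinearMap.add_apply, LinearMap.smul_apply, smul_eq_mul]
    ring
  rw [hsplit, hsplit fun i => Pi.single i 1] at hle
  have hlt := hfeas T hT 0 le_rfl
  rw [add_zero] at hlt
  have hnn : 0 ≤ ε * ∑ i, (1 + w i) * E (rowSq (T i)) :=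
    mul_nonneg hε.le (Finset.sum_nonneg fun i _ =>
      mul_nonneg (by have := hw i; positivity) (hE_nonneg _))
  change _ ≤ f (α, β) + ε * κ at hle
  linarith

end Feasible

/-! ### Diagonalization of couples. -/

section Couples

namespace HilbertCouple

variable {M H₀ H₁ : Type*}
  [AddCommGroup M] [Module ℂ M] [TopologicalSpace M] [IsTopologicalAddGroup M]
  [ContinuousSMul ℂ M] [T2Space M]
  [NormedAddCommGroup H₀] [InnerProductSpace ℂ H₀] [CompleteSpace H₀]
  [NormedAddCommGroup H₁] [InnerProductSpace ℂ H₁] [CompleteSpace H₁]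

/-- Coordinates that identify a couple with a weighted couple `(ℓ₂ⁿ, ℓ₂ⁿ(w))`. -/
structure DiagonalCoords (C : HilbertCouple M H₀ H₁) {n : ℕ} (w : Fin n → ℝ) where
  coord₀ : H₀ ≃ₗ[ℂ] (Fin n → ℂ)
  coord₁ : H₁ ≃ₗ[ℂ] (Fin n → ℂ)
  emb_eq : ∀ z, C.emb₀ (coord₀.symm z) = C.emb₁ (coord₁.symm z)
  norm_sq₀ : ∀ u, ‖u‖ ^ 2 = ∑ i, ‖coord₀ u i‖ ^ 2
  norm_sq₁ : ∀ v, ‖v‖ ^ 2 = ∑ i, w i * ‖coord₁ v i‖ ^ 2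

namespace DiagonalCoords

variable {C : HilbertCouple M H₀ H₁} {n : ℕ} {w : Fin n → ℝ}

/-- Coordinatewise, with `τ = t w i`, the minimum of `|a|² + τ |b|²` over `a + b = z` is `τ/(1+τ)
|z|²`, attained at `a = τ z/(1+τ)`. The lower bound rests on `(1+τ)(p² + τ q²) - τ (p+q)² = (p - τ
q)²`. -/
theorem K_eq (c : C.DiagonalCoords w) (hw : ∀ i, 0 < w i) {t : ℝ} (ht : 0 < t)
    (z : Fin n → ℂ) :
    C.K t (C.emb₀ (c.coord₀.symm z)) =
      ENNReal.ofReal (∑ i, t * w i / (1 + t * w i) * ‖z i‖ ^ 2) := by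
  have hpos : ∀ i, 0 < t * w i := fun i => mul_pos ht (hw i)
  refine le_antisymm ?_ ?_
  · set a : Fin n → ℂ := fun i => ((t * w i / (1 + t * w i) : ℝ) : ℂ) * z i
    set b : Fin n → ℂ := fun i => ((1 / (1 + t * w i) : ℝ) : ℂ) * z i
    have hab : z = a + b := by
      funext i
      have : 1 + t * w i ≠ 0 := by have := hpos i; positivity
      simp only [a, b, Pi.add_apply, ← add_mul, ← Complex.ofReal_add, ← add_div]
      rw [add_comm (t * w i), div_self this, Complex.ofReal_one, one_mul]
    refine (iInf_le_of_le (c.coord₀.symm a) (iInf_le_of_le (c.coord₁.symm b)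
      (iInf_le_of_le ?_ le_rfl))).trans (ENNReal.ofReal_le_ofReal (le_of_eq ?_))
    · rw [← c.emb_eq, ← map_add, ← map_add, ← hab]
    · rw [c.norm_sq₀, c.norm_sq₁, Finset.mul_sum, ← Finset.sum_add_distrib]
      refine Finset.sum_congr rfl fun i _ => ?_
      have := hpos i
      simp only [LinearEquiv.apply_symm_apply, a, b, norm_mul, Complex.norm_real, mul_pow,
        Real.norm_eq_abs, sq_abs]
      field_simp
      ring
  · refine le_iInf fun u => le_iInf fun v => le_iInf fun huv => ENNReal.ofReal_le_ofReal ?_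
    have hz : z = c.coord₀ u + c.coord₁ v := by
      have hv : C.emb₁ v = C.emb₀ (c.coord₀.symm (c.coord₁ v)) := by
        rw [c.emb_eq, LinearEquiv.symm_apply_apply]
      rw [hv, ← map_add] at huv
      rw [← c.coord₀.apply_symm_apply z, C.injective_emb₀ huv, map_add,
        LinearEquiv.apply_symm_apply]
    rw [c.norm_sq₀, c.norm_sq₁, Finset.mul_sum, ← Finset.sum_add_distrib]
    refine Finset.sum_le_sum fun i _ => ?_
    have h1 : ‖z i‖ ^ 2 ≤ (‖c.coord₀ u i‖ + ‖c.coord₁ v i‖) ^ 2 := by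
      rw [hz]
      exact pow_le_pow_left₀ (norm_nonneg _) (norm_add_le _ _) 2
    have hp := hpos i
    rw [div_mul_eq_mul_div, div_le_iff₀ (by positivity)]
    have h2 := mul_le_mul_of_nonneg_left h1 hp.le
    nlinarith [sq_nonneg (‖c.coord₀ u i‖ - t * w i * ‖c.coord₁ v i‖)]

theorem sum_le_of_K_le (c : C.DiagonalCoords w) (hw : ∀ i, 0 < w i) {x y : Fin n → ℂ}
    (h : ∀ t : ℝ, 0 < t → C.K t (C.emb₀ (c.coord₀.symm y)) ≤ C.K t (C.emb₀ (c.coord₀.symm x)))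
    (t : ℝ) (ht : 0 < t) :
    ∑ i, w i / (t + w i) * ‖y i‖ ^ 2 ≤ ∑ i, w i / (t + w i) * ‖x i‖ ^ 2 := by
  have e : ∀ i, t⁻¹ * w i / (1 + t⁻¹ * w i) = w i / (t + w i) := fun i => by
    have := hw i
    field_simp
  have := h t⁻¹ (inv_pos.2 ht)
  rw [c.K_eq hw (inv_pos.2 ht), c.K_eq hw (inv_pos.2 ht), ENNReal.ofReal_le_ofReal_iff] at this
  · simpa only [e] using this
  · exact Finset.sum_nonneg fun i _ => by
      have := hw i
      positivity

/-- A diagonalizable couple has the `K`-property. -/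
theorem kProperty (c : C.DiagonalCoords w) (hw : ∀ i, 0 < w i) : C.KProperty := by
  have : FiniteDimensional ℂ H₀ := Module.Finite.equiv c.coord₀.symm
  have : FiniteDimensional ℂ H₁ := Module.Finite.equiv c.coord₁.symm
  let e₀ : (Fin n → ℂ) →ₗ[ℂ] C.sum :=
    ((C.emb₀ : H₀ →ₗ[ℂ] M) ∘ₗ (c.coord₀.symm : (Fin n → ℂ) →ₗ[ℂ] H₀)).codRestrict C.sum
      fun z => C.emb₀_mem_sum _
  have he₀ : ∀ z, (e₀ z : M) = C.emb₀ (c.coord₀.symm z) := fun z => rfl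
  have hbij : Function.Bijective e₀ := by
    refine ⟨fun z z' hz => ?_, fun s => ?_⟩
    · have := congrArg Subtype.val hz
      rw [he₀, he₀] at this
      exact c.coord₀.symm.injective (C.injective_emb₀ this)
    · obtain ⟨_, ⟨u, rfl⟩, _, ⟨v, rfl⟩, hs⟩ := Submodule.mem_sup.1 s.2
      refine ⟨c.coord₀ u + c.coord₁ v, Subtype.ext ?_⟩
      rw [he₀, map_add, map_add, LinearEquiv.symm_apply_apply, c.emb_eq,
        LinearEquiv.symm_apply_apply]
      exact hs
  let e := LinearEquiv.ofBijective e₀ hbij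
  have he : ∀ z, (e z : M) = C.emb₀ (c.coord₀.symm z) := he₀
  have he₁ : ∀ z, (e z : M) = C.emb₁ (c.coord₁.symm z) := fun z => by rw [he, c.emb_eq]
  intro x y hxy
  obtain ⟨x, rfl⟩ := e.surjective x
  obtain ⟨y, rfl⟩ := e.surjective y
  simp only [he] at hxy
  obtain ⟨T, hTx, hT₀, hT₁⟩ := exists_matrix_contraction hw (c.sum_le_of_K_le hw hxy)
  refine ⟨{
    toLinearMap := e.toLinearMap ∘ₗ T.mulVecLin ∘ₗ e.symm.toLinearMap
    map₀ := LinearMap.toContinuousLinearMap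
      (c.coord₀.symm.toLinearMap ∘ₗ T.mulVecLin ∘ₗ c.coord₀.toLinearMap)
    map₁ := LinearMap.toContinuousLinearMap
      (c.coord₁.symm.toLinearMap ∘ₗ T.mulVecLin ∘ₗ c.coord₁.toLinearMap)
    restrict₀ := fun u => ?_
    restrict₁ := fun v => ?_ }, ?_, ?_⟩
  · have hu : (⟨C.emb₀ u, C.emb₀_mem_sum u⟩ : C.sum) = e (c.coord₀ u) :=
      Subtype.ext (by rw [he, LinearEquiv.symm_apply_apply])
    rw [hu]
    simp [he]
  · have hv : (⟨C.emb₁ v, C.emb₁_mem_sum v⟩ : C.sum) = e (c.coord₁ v) :=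
      Subtype.ext (by rw [he₁, LinearEquiv.symm_apply_apply])
    rw [hv]
    simp [he₁]
  · simp [hTx]
  · refine max_le ?_ ?_ <;>
    refine ContinuousLinearMap.opNorm_le_bound _ zero_le_one fun u => ?_ <;>
    rw [one_mul] <;>
    refine le_of_sq_le_sq ?_ (norm_nonneg u)
    · rw [c.norm_sq₀, c.norm_sq₀]
      simpa using hT₀ (c.coord₀ u)
    · rw [c.norm_sq₁, c.norm_sq₁]
      simpa using hT₁ (c.coord₁ u)

end DiagonalCoords

/-- Both spaces of a regular finite-dimensional couple have the same image. -/
theorem Regular.range_eq [FiniteDimensional ℂ H₀] [FiniteDimensional ℂ H₁]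
    {C : HilbertCouple M H₀ H₁} (hC : C.Regular) :
    LinearMap.range (C.emb₀ : H₀ →ₗ[ℂ] M) = LinearMap.range (C.emb₁ : H₁ →ₗ[ℂ] M) := by
  refine le_antisymm ?_ ?_
  · rintro _ ⟨u, rfl⟩
    let S : Submodule ℂ H₀ := (LinearMap.range (C.emb₁ : H₁ →ₗ[ℂ] M)).comap C.emb₀.toLinearMap
    have hS : (S : Set H₀) = {u : H₀ | ∃ v : H₁, C.emb₀ u = C.emb₁ v} := by
      ext u
      exact exists_congr fun v => eq_comm
    -- A subspace of a finite-dimensional space is closed, so a dense one is everything.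
    have hd : Dense (S : Set H₀) := hS ▸ hC.1
    have hmem : u ∈ (S : Set H₀) := by
      rw [← S.closed_of_finiteDimensional.closure_eq, hd.closure_eq]
      trivial
    exact hmem
  · rintro _ ⟨v, rfl⟩
    let S : Submodule ℂ H₁ := (LinearMap.range (C.emb₀ : H₀ →ₗ[ℂ] M)).comap C.emb₁.toLinearMap
    have hS : (S : Set H₁) = {v : H₁ | ∃ u : H₀, C.emb₀ u = C.emb₁ v} := rfl
    have hd : Dense (S : Set H₁) := hS ▸ hC.2
    have hmem : v ∈ (S : Set H₁) := by
      rw [← S.closed_of_finiteDimensional.closure_eq, hd.closure_eq]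
      trivial
    exact hmem

/-- A regular finite-dimensional couple is isometric to a weighted couple: the operator of the
couple has an orthonormal basis of eigenvectors. -/
theorem Regular.exists_diagonalCoords [FiniteDimensional ℂ H₀] [FiniteDimensional ℂ H₁]
    {C : HilbertCouple M H₀ H₁} (hC : C.Regular) :
    ∃ (n : ℕ) (w : Fin n → ℝ), (∀ i, 0 < w i) ∧ Nonempty (C.DiagonalCoords w) := by
  let J : H₀ ≃ₗ[ℂ] H₁ :=
    (LinearEquiv.ofInjective (C.emb₀ : H₀ →ₗ[ℂ] M) C.injective_emb₀).trans
      ((LinearEquiv.ofEq _ _ hC.range_eq).trans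
        (LinearEquiv.ofInjective (C.emb₁ : H₁ →ₗ[ℂ] M) C.injective_emb₁).symm)
  have hJ : ∀ u, C.emb₁ (J u) = C.emb₀ u := fun u =>
    congrArg Subtype.val ((LinearEquiv.ofInjective (C.emb₁ : H₁ →ₗ[ℂ] M)
      C.injective_emb₁).apply_symm_apply _)
  -- As `J` is the identification of `H₀` with `H₁` inside `M`, `J* J` represents the form `‖·‖₁²`
  -- in `H₀`.
  let A : H₀ →ₗ[ℂ] H₀ := LinearMap.adjoint J.toLinearMap ∘ₗ J.toLinearMap
  have hA : ∀ u v, ⟪A u, v⟫_ℂ = ⟪J u, J v⟫_ℂ := fun u v =>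
    LinearMap.adjoint_inner_left J.toLinearMap v (J u)
  have hsymm : A.IsSymmetric := fun u v => by
    rw [hA, ← inner_conj_symm u, hA, inner_conj_symm]
  let b := hsymm.eigenvectorBasis rfl
  let c₀ : H₀ ≃ₗ[ℂ] (Fin (Module.finrank ℂ H₀) → ℂ) :=
    b.repr.toLinearEquiv.trans (WithLp.linearEquiv 2 ℂ _)
  have hc₀ : ∀ u i, c₀ u i = b.repr u i := fun _ _ => rfl
  have hnorm : ∀ u, ‖J u‖ ^ 2 = ∑ i, hsymm.eigenvalues rfl i * ‖c₀ u i‖ ^ 2 := by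
    intro u
    rw [@norm_sq_eq_re_inner ℂ, ← hA, ← b.repr.inner_map_map, PiLp.inner_apply, map_sum]
    refine Finset.sum_congr rfl fun i _ => ?_
    rw [hsymm.eigenvectorBasis_apply_self_apply, hc₀, ← smul_eq_mul, inner_smul_left,
      RCLike.conj_ofReal, inner_self_eq_norm_sq_to_K, RCLike.re_ofReal_mul]
    norm_cast
  refine ⟨_, hsymm.eigenvalues rfl, fun i => ?_, ⟨{
    coord₀ := c₀
    coord₁ := J.symm.trans c₀
    emb_eq := fun z => (hJ _).symm
    norm_sq₀ := fun u => ?_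
    norm_sq₁ := fun v => ?_ }⟩⟩
  · have h1 := hnorm (b i)
    have h2 : J (b i) ≠ 0 := by
      simpa using b.orthonormal.ne_zero i
    have h3 : ∀ j, ‖c₀ (b i) j‖ ^ 2 = if j = i then 1 else 0 := by
      intro j
      rw [hc₀, b.repr_self, PiLp.single_apply]
      split_ifs <;> simp
    simp only [h3, mul_ite, mul_one, mul_zero, Finset.sum_ite_eq', Finset.mem_univ,
      if_true] at h1
    rw [← h1]
    have := norm_pos_iff.2 h2
    positivity
  · rw [← b.repr.norm_map, EuclideanSpace.norm_sq_eq]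
    rfl
  · simpa using hnorm (J.symm v)

end HilbertCouple

/-- The standard coordinates of the weighted couple. -/
def weightedCouple.diagonalCoords {n : ℕ} (w : Fin n → {r : ℝ // 0 < r}) :
    (weightedCouple w).DiagonalCoords fun i => (w i : ℝ) where
  coord₀ := WithLp.linearEquiv 2 ℂ (Fin n → ℂ)
  coord₁ := (WeightedEll2.ofVec w).symm
  emb_eq _ := rfl
  norm_sq₀ u := EuclideanSpace.norm_sq_eq u
  norm_sq₁ v := by
    have := WeightedEll2.norm_sq_ofVec w ((WeightedEll2.ofVec w).symm v)
    rwa [LinearEquiv.apply_symm_apply] at this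

end Couples

theorem theorem2p5 :
    (∀ (M H₀ H₁ : Type*)
      [AddCommGroup M] [Module ℂ M] [TopologicalSpace M] [IsTopologicalAddGroup M]
      [ContinuousSMul ℂ M] [T2Space M]
      [NormedAddCommGroup H₀] [InnerProductSpace ℂ H₀] [CompleteSpace H₀]
      [NormedAddCommGroup H₁] [InnerProductSpace ℂ H₁] [CompleteSpace H₁]
      [FiniteDimensional ℂ H₀] [FiniteDimensional ℂ H₁]
      (C : HilbertCouple M H₀ H₁),
      C.Regular → C.HasSimpleEigenvalues → C.KProperty) ∧
    (∀ (n : ℕ) (w : Fin n → {r : ℝ // 0 < r}), StrictMono w →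
      ∀ x₀ y₀ : Fin n → ℂ,
        (∀ t : ℝ, 0 < t → weightedK w t y₀ ≤ weightedK w t x₀) →
        ∃ T : Matrix (Fin n) (Fin n) ℂ,
          T *ᵥ x₀ = y₀ ∧
          (∀ x : Fin n → ℂ,
            ‖(WithLp.toLp 2 (T *ᵥ x) : EuclideanSpace ℂ (Fin n))‖ ≤
              ‖(WithLp.toLp 2 x : EuclideanSpace ℂ (Fin n))‖) ∧
          (∀ x : Fin n → ℂ,
            ‖WeightedEll2.ofVec w (T *ᵥ x)‖ ≤ ‖WeightedEll2.ofVec w x‖)) := by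
  refine ⟨?_, ?_⟩
  · intro M H₀ H₁ _ _ _ _ _ _ _ _ _ _ _ _ _ _ C hC _
    obtain ⟨n, w, hw, ⟨c⟩⟩ := hC.exists_diagonalCoords
    exact c.kProperty hw
  · intro n w _ x₀ y₀ h
    have hw : ∀ i, 0 < (w i : ℝ) := fun i => (w i).2
    obtain ⟨T, hT, hT₀, hT₁⟩ := exists_matrix_contraction hw
      ((weightedCouple.diagonalCoords w).sum_le_of_K_le hw (x := x₀) (y := y₀) fun t ht => by
        -- `weightedK` at `t⁻¹` is the K-functional at `t`.
        have := h t⁻¹ (inv_pos.2 ht)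
        simp only [weightedK, one_div, inv_inv] at this
        exact this)
    refine ⟨T, hT, fun x => ?_, fun x => ?_⟩
    · refine le_of_sq_le_sq ?_ (norm_nonneg _)
      rw [EuclideanSpace.norm_sq_eq, EuclideanSpace.norm_sq_eq]
      exact hT₀ x
    · refine le_of_sq_le_sq ?_ (norm_nonneg _)
      rw [WeightedEll2.norm_sq_ofVec, WeightedEll2.norm_sq_ofVec]
      exact hT₁ x
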